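/- Let $n\ge 1$, and let $P,Q$ be $n\times n$ (complex) permutation matrices with corresponding permutations $\omega(P),\omega(Q)\in \mathrm{S}_n$, i.e. $Pe_j=e_{\omega(P)(j)}$ for all $j$. For $A,B\in\mathbb{C}^{n\times n}$ with rows and columns indexed by $0,\dots,n-1$, let $A\diamond B$ be the convolution $(A\diamond B)_{ij}=\sum_{\ell=0}^{i}\sum_{\kappa=0}^{j}a_{\ell,\kappa}\,b_{i-\ell,j-\kappa}$. Let $\mathbf{1}$ be the $n\times n$ matrix whose entries are all equal to $1$, let $\nabla$ be the $n\times n$ anti-diagonal permutation matrix, and let $\le_{\mathrm{Entry}}$ denote entrywise comparison of matrices. Let $\le_{\mathrm{Bruhat}}$ denote the (strong) Bruhat order on $\mathrm{S}_n$, i.e. the reflexive and transitive closure of the relation $u\to ut$, where $t$ is a transposition and $ut$ has more inversions than $u$. Then the following eight statements are equivalent: \begin{enumerate} \item $\omega(Q)\le_{\mathrm{Bruhat}}\omega(P)$; \item $P\diamond\mathbf{1}\le_{\mathrm{Entry}}Q\diamond\mathbf{1}$; \item $\omega(\nabla)\omega(P)\le_{\mathrm{Bruhat}}\omega(\nabla)\omega(Q)$;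 \item $(\nabla Q)\diamond\mathbf{1}\le_{\mathrm{Entry}}(\nabla P)\diamond\mathbf{1}$; \item $\omega(P)\omega(\nabla)\le_{\mathrm{Bruhat}}\omega(Q)\omega(\nabla)$; \item $(Q\nabla)\diamond\mathbf{1}\le_{\mathrm{Entry}}(P\nabla)\diamond\mathbf{1}$; \item $\omega(Q)^{-1}\le_{\mathrm{Bruhat}}\omega(P)^{-1}$; \item $P^T\diamond\mathbf{1}\le_{\mathrm{Entry}}Q^T\diamond\mathbf{1}$. \end{enumerate} -/

import Mathlib

/-- The convolution `A ⋄ B` of two complex `M × N` matrices (with indices starting at `0`):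
`(A ⋄ B) i j = ∑_{l ≤ i} ∑_{k ≤ j} A l k * B (i - l) (j - k)`. -/
def matConv {M N : ℕ} (A B : Matrix (Fin M) (Fin N) ℂ) : Matrix (Fin M) (Fin N) ℂ :=
  fun i j => ∑ l ∈ Finset.Iic i, ∑ k ∈ Finset.Iic j,
    A l k * B ⟨i.val - l.val, lt_of_le_of_lt (Nat.sub_le _ _) i.isLt⟩
      ⟨j.val - k.val, lt_of_le_of_lt (Nat.sub_le _ _) j.isLt⟩

/-- The matrix all of whose entries are `1`. -/
def allOnes (n : ℕ) : Matrix (Fin n) (Fin n) ℂ := fun _ _ => 1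

section
open scoped ComplexOrder

/-- Entrywise comparison of complex matrices; `z ≤ w` in `ℂ` means that `w - z` is a
nonnegative real number. -/
def EntryLE {M N : ℕ} (A B : Matrix (Fin M) (Fin N) ℂ) : Prop := ∀ i j, A i j ≤ B i j

end

/-- The permutation matrix of `σ`, i.e. the matrix of the linear map `e_j ↦ e_{σ j}`. -/
def permMat {n : ℕ} (σ : Equiv.Perm (Fin n)) : Matrix (Fin n) (Fin n) ℂ :=
  fun i j => if i = σ j then 1 else 0

/-- `P` is a permutation matrix. -/
def IsPermMat {n : ℕ} (P : Matrix (Fin n) (Fin n) ℂ) : Prop :=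
  ∃ σ : Equiv.Perm (Fin n), P = permMat σ

/-- The permutation `ω(P)` of a permutation matrix `P`, so that `P e_j = e_{ω(P) j}`. -/
noncomputable def permOf {n : ℕ} {P : Matrix (Fin n) (Fin n) ℂ} (hP : IsPermMat P) :
    Equiv.Perm (Fin n) := hP.choose

theorem permMat_permOf {n : ℕ} {P : Matrix (Fin n) (Fin n) ℂ} (hP : IsPermMat P) :
    permMat (permOf hP) = P := hP.choose_spec.symm

/-- A permutation matrix determines its permutation. -/
theorem permMat_injective {n : ℕ} :
    Function.Injective (permMat : Equiv.Perm (Fin n) → Matrix (Fin n) (Fin n) ℂ) := by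
  intro σ τ h
  ext j : 1
  have h1 := congrFun (congrFun h (σ j)) j
  by_contra hne
  simp [permMat, hne] at h1

/-- The anti-diagonal matrix: its `(i, j)` entry is `1` if `i + j = n - 1`, and `0` otherwise. -/
def antiDiag (n : ℕ) : Matrix (Fin n) (Fin n) ℂ :=
  fun i j => if i.val + j.val + 1 = n then 1 else 0

theorem isPermMat_antiDiag (n : ℕ) : IsPermMat (antiDiag n) := by
  refine ⟨Fin.revPerm, ?_⟩
  ext i j
  have h : (i.val + j.val + 1 = n) ↔ i = Fin.revPerm j := by
    rw [Fin.ext_iff, Fin.revPerm_apply, Fin.val_rev]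
    omega
  simp [antiDiag, permMat, h]

/-- The length of a permutation: its number of inversions. -/
def invNumber {n : ℕ} (σ : Equiv.Perm (Fin n)) : ℕ :=
  (Finset.univ.filter fun x : Fin n × Fin n => x.1 < x.2 ∧ σ x.2 < σ x.1).card

/-- A step of the Bruhat order: `v = u * t` for a transposition `t`, and `v` is longer than `u`. -/
def BruhatStep {n : ℕ} (u v : Equiv.Perm (Fin n)) : Prop :=
  ∃ t : Equiv.Perm (Fin n), t.IsSwap ∧ v = u * t ∧ invNumber u < invNumber v

/-- The (strong) Bruhat order on the symmetric group: the reflexive transitive closure of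
`BruhatStep`. -/
def BruhatLE {n : ℕ} (u v : Equiv.Perm (Fin n)) : Prop :=
  Relation.ReflTransGen BruhatStep u v

/-! All eight conditions reduce to one comparison of rank functions, `RankLE`. The entries of `P ⋄
1` are rank counts, and `bruhatLE_iff_rankLE` handles the Bruhat order. Inversion transposes the
rank function, left multiplication by `Fin.revPerm` complements it, and right multiplication is the
left one conjugated by inversion. The hard direction is `RankLE.exists_step`: if `u ≠ v` lies below
`v` in rank, some transposition lengthens `u` and keeps it below `v`. Lengths are bounded, so
iterating reaches `v`. -/

/-- The rank function of a permutation: the number of positions `k < b` with value `σ k < a`. -/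
def rankCount {n : ℕ} (σ : Equiv.Perm (Fin n)) (a b : ℕ) : ℕ :=
  (Finset.univ.filter fun k : Fin n => k.val < b ∧ (σ k).val < a).card

/-- The comparison of permutations by their rank functions. -/
def RankLE {n : ℕ} (u v : Equiv.Perm (Fin n)) : Prop :=
  ∀ a b, rankCount v a b ≤ rankCount u a b

/-! ### Symmetries of the rank function -/

theorem rankCount_inv {n : ℕ} (σ : Equiv.Perm (Fin n)) (a b : ℕ) :
    rankCount σ⁻¹ a b = rankCount σ b a := by
  symm
  unfold rankCount
  refine Finset.card_bij (fun k _ => σ k) ?_ (fun _ _ _ _ h => σ.injective h) ?_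
  · intro k hk
    simp only [Finset.mem_filter, Finset.mem_univ, true_and] at hk ⊢
    simpa using hk.symm
  · intro k hk
    simp only [Finset.mem_filter, Finset.mem_univ, true_and] at hk
    refine ⟨σ⁻¹ k, ?_, by simp⟩
    simpa using hk.symm

/-- A reversed value is below `a` exactly when the original is at least `n - a`, so the two counts
partition the first `b` positions. -/
theorem rankCount_revPerm_mul {n : ℕ} (σ : Equiv.Perm (Fin n)) (a b : ℕ) :
    rankCount (Fin.revPerm * σ) a b + rankCount σ (n - a) b =
      (Finset.univ.filter fun k : Fin n => k.val < b).card := by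
  unfold rankCount
  rw [← Finset.card_filter_add_card_filter_not (s := Finset.univ.filter fun k : Fin n => k.val < b)
    (fun k => n ≤ (σ k).val + a), Finset.filter_filter, Finset.filter_filter]
  congr 2
  · ext k
    have := (σ k).isLt
    simp only [Finset.mem_filter, Finset.mem_univ, true_and, Equiv.Perm.mul_apply,
      Fin.revPerm_apply, Fin.val_rev]
    omega
  · ext k
    simp only [Finset.mem_filter, Finset.mem_univ, true_and]
    omega

theorem RankLE.inv {n : ℕ} {u v : Equiv.Perm (Fin n)} (h : RankLE u v) : RankLE u⁻¹ v⁻¹ := by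
  intro a b
  rw [rankCount_inv, rankCount_inv]
  exact h b a

theorem rankLE_inv_iff {n : ℕ} {u v : Equiv.Perm (Fin n)} : RankLE u⁻¹ v⁻¹ ↔ RankLE u v :=
  ⟨fun h => by simpa using h.inv, RankLE.inv⟩

theorem revPerm_mul_self (n : ℕ) : (Fin.revPerm * Fin.revPerm : Equiv.Perm (Fin n)) = 1 := by
  ext k
  simp

theorem revPerm_inv (n : ℕ) : (Fin.revPerm : Equiv.Perm (Fin n))⁻¹ = Fin.revPerm :=
  inv_eq_of_mul_eq_one_left (revPerm_mul_self n)

theorem RankLE.revPerm_mul {n : ℕ} {u v : Equiv.Perm (Fin n)} (h : RankLE u v) :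
    RankLE (Fin.revPerm * v) (Fin.revPerm * u) := by
  intro a b
  have h1 := rankCount_revPerm_mul u a b
  have h2 := rankCount_revPerm_mul v a b
  have h3 := h (n - a) b
  omega

theorem rankLE_revPerm_mul_iff {n : ℕ} {u v : Equiv.Perm (Fin n)} :
    RankLE (Fin.revPerm * v) (Fin.revPerm * u) ↔ RankLE u v := by
  refine ⟨fun h => ?_, RankLE.revPerm_mul⟩
  have := h.revPerm_mul
  rwa [← mul_assoc, ← mul_assoc, revPerm_mul_self, one_mul, one_mul] at this

theorem rankLE_mul_revPerm_iff {n : ℕ} {u v : Equiv.Perm (Fin n)} :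
    RankLE (v * Fin.revPerm) (u * Fin.revPerm) ↔ RankLE u v := by
  rw [← rankLE_inv_iff, mul_inv_rev, mul_inv_rev, revPerm_inv, rankLE_revPerm_mul_iff,
    rankLE_inv_iff]

/-! ### Bruhat steps lower the rank function -/

/-- The effect on the rank function of exchanging the values at two positions that are not
inverted. -/
theorem rankCount_mul_swap {n : ℕ} (u : Equiv.Perm (Fin n)) {i j : Fin n} (hij : i < j)
    (hu : u i < u j) (a b : ℕ) :
    rankCount (u * Equiv.swap i j) a b +
      (if i.val < b ∧ b ≤ j.val ∧ (u i).val < a ∧ a ≤ (u j).val then 1 else 0) =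
        rankCount u a b := by
  have hne : j ∈ Finset.univ.erase i := by simp [hij.ne']
  simp only [rankCount, Finset.card_filter]
  rw [← Finset.add_sum_erase _ _ (Finset.mem_univ i), ← Finset.add_sum_erase _ _ hne,
    ← Finset.add_sum_erase (a := i) _ _ (Finset.mem_univ i), ← Finset.add_sum_erase _ _ hne]
  have hrest : ∑ k ∈ (Finset.univ.erase i).erase j,
      (if k.val < b ∧ ((u * Equiv.swap i j) k).val < a then 1 else 0) =
      ∑ k ∈ (Finset.univ.erase i).erase j, if k.val < b ∧ (u k).val < a then 1 else 0 := by
    refine Finset.sum_congr rfl fun k hk => ?_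
    simp only [Finset.mem_erase, Finset.mem_univ, and_true] at hk
    rw [Equiv.Perm.mul_apply, Equiv.swap_apply_of_ne_of_ne hk.2 hk.1]
  rw [hrest]
  simp only [Equiv.Perm.mul_apply, Equiv.swap_apply_left, Equiv.swap_apply_right]
  rw [Fin.lt_def] at hij hu
  split_ifs <;> omega

theorem rankLE_mul_swap {n : ℕ} (u : Equiv.Perm (Fin n)) {i j : Fin n} (hij : i < j)
    (hu : u i < u j) : RankLE u (u * Equiv.swap i j) := fun a b =>
  (Nat.le_add_right _ _).trans (rankCount_mul_swap u hij hu a b).le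

/-- Exchanging the values at two positions that are not inverted creates inversions. -/
theorem invNumber_lt_mul_swap {n : ℕ} (u : Equiv.Perm (Fin n)) {i j : Fin n} (hij : i < j)
    (hu : u i < u j) : invNumber u < invNumber (u * Equiv.swap i j) := by
  set t := Equiv.swap i j with ht
  have htt : ∀ x, t (t x) = x := fun x => by simp [ht]
  have hti : t i = j := by simp [ht]
  have htj : t j = i := by simp [ht]
  have hto : ∀ x, x ≠ i → x ≠ j → t x = x := fun x => Equiv.swap_apply_of_ne_of_ne
  clear_value t
  unfold invNumber
  set S := Finset.univ.filter fun x : Fin n × Fin n => x.1 < x.2 ∧ (u * t) x.2 < (u * t) x.1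
  have hS : ∀ x, x ∈ S ↔ x.1 < x.2 ∧ u (t x.2) < u (t x.1) := fun x => by
    rw [Finset.mem_filter_univ, Equiv.Perm.mul_apply, Equiv.Perm.mul_apply]
  have hmem : (i, j) ∈ S := by simp [hS, hti, htj, hij, hu]
  refine lt_of_le_of_lt ?_ (Finset.card_erase_lt_of_mem hmem)
  -- Inversions of `u` inject into those of `u * t` other than `(i, j)`: move a pair by `t` if this
  -- keeps it increasing, otherwise leave it fixed.
  refine Finset.card_le_card_of_injOn
    (fun x => if t x.1 < t x.2 then (t x.1, t x.2) else x) ?_ ?_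
  · rintro ⟨x, y⟩ hxy
    simp only [Finset.coe_filter, Finset.mem_univ, true_and, Set.mem_ofPred_eq] at hxy
    obtain ⟨h1, h2⟩ := hxy
    simp only [Finset.coe_erase, Set.mem_sdiff, Finset.mem_coe, Set.mem_singleton_iff]
    by_cases h : t x < t y
    · simp only [if_pos h]
      refine ⟨by simp [hS, h, htt, h2], fun he => ?_⟩
      rw [Prod.mk.injEq] at he
      have hx : x = j := by rw [← htt x, he.1, hti]
      have hy : y = i := by rw [← htt y, he.2, htj]
      subst hx hy
      exact lt_asymm h1 hij
    · simp only [if_neg h]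
      constructor
      · refine (hS _).2 ⟨h1, ?_⟩
        dsimp only
        rcases eq_or_ne x i with rfl | hxi
        · rcases eq_or_ne y j with rfl | hyj
          · exact absurd h2 hu.not_gt
          · rw [hti, hto y h1.ne' hyj]
            exact h2.trans hu
        · rcases eq_or_ne y j with rfl | hyj
          · rw [htj, hto x hxi h1.ne]
            exact hu.trans h2
          · rcases eq_or_ne x j with rfl | hxj
            · have hyi : y ≠ i := (hij.trans h1).ne'
              rw [htj, hto y hyi hyj] at h
              exact absurd (hij.trans h1) h
            · rcases eq_or_ne y i with rfl | hyi
              · rw [hti, hto x hxi hxj] at h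
                exact absurd (h1.trans hij) h
              · rwa [hto x hxi hxj, hto y hyi hyj]
      · rw [Prod.mk.injEq]
        rintro ⟨rfl, rfl⟩
        exact lt_asymm h2 hu
  · rintro ⟨x, y⟩ hxy ⟨z, w⟩ hzw he
    simp only [Finset.coe_filter, Finset.mem_univ, true_and, Set.mem_ofPred_eq] at hxy hzw
    dsimp only at he
    split_ifs at he with h1 h2 h2
    · simp only [Prod.mk.injEq, EmbeddingLike.apply_eq_iff_eq] at he
      simp [he.1, he.2]
    · rw [Prod.mk.injEq] at he
      rw [← he.1, ← he.2, htt, htt] at h2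
      exact absurd hxy.1 h2
    · rw [Prod.mk.injEq] at he
      rw [he.1, he.2, htt, htt] at h1
      exact absurd hzw.1 h1
    · exact he

theorem BruhatStep.rankLE {n : ℕ} {u v : Equiv.Perm (Fin n)} (h : BruhatStep u v) :
    RankLE u v := by
  obtain ⟨t, ⟨i, j, hij, rfl⟩, rfl, hlt⟩ := h
  wlog hlt' : i < j generalizing i j
  · have hji : j < i := lt_of_le_of_ne (not_lt.mp hlt') hij.symm
    rw [Equiv.swap_comm] at hlt ⊢
    exact this j i hij.symm hlt hji
  refine rankLE_mul_swap u hlt' ?_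
  by_contra hu
  have hu' : u j < u i := lt_of_le_of_ne (not_lt.mp hu) (u.injective.ne hij.symm)
  -- If `u` already inverted `i, j`, swapping back would add inversions, against `hlt`.
  have := invNumber_lt_mul_swap (u * Equiv.swap i j) hlt' (by simpa using hu')
  rw [mul_assoc, Equiv.swap_mul_self, mul_one] at this
  exact lt_asymm hlt this

theorem BruhatLE.rankLE {n : ℕ} {u v : Equiv.Perm (Fin n)} (h : BruhatLE u v) : RankLE u v := by
  induction h with
  | refl => exact fun _ _ => le_rfl
  | tail _ hs ih => exact fun a b => (hs.rankLE a b).trans (ih a b)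

/-! ### From rank comparison to Bruhat chains -/

theorem rankCount_add_card {n : ℕ} (σ : Equiv.Perm (Fin n)) {a c : ℕ} (hac : a ≤ c) (b : ℕ) :
    rankCount σ a b +
      (Finset.univ.filter fun k : Fin n => k.val < b ∧ a ≤ (σ k).val ∧ (σ k).val < c).card =
        rankCount σ c b := by
  unfold rankCount
  rw [← Finset.card_filter_add_card_filter_not
    (s := Finset.univ.filter fun k : Fin n => k.val < b ∧ (σ k).val < c)
    (fun k => (σ k).val < a), Finset.filter_filter, Finset.filter_filter]
  congr 2 <;>
  · ext k
    simp only [Finset.mem_filter, Finset.mem_univ, true_and]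
    omega

/-- Two different permutations comparable by their rank functions admit a first position where they
differ, and the smaller one has the smaller value there. -/
theorem RankLE.exists_first_diff {n : ℕ} {u v : Equiv.Perm (Fin n)} (h : RankLE u v)
    (hne : u ≠ v) : ∃ d, (∀ k < d, u k = v k) ∧ u d < v d := by
  have hex : ∃ d, u d ≠ v d := by
    by_contra! hall
    exact hne (Equiv.ext hall)
  obtain ⟨d, hd, hmin⟩ := WellFounded.has_min (wellFounded_lt (α := Fin n)) {d | u d ≠ v d} hex
  have hpre : ∀ k < d, u k = v k := fun k hk => by
    by_contra hk'
    exact hmin k hk' hk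
  refine ⟨d, hpre, ?_⟩
  by_contra hlt
  have hgt : v d < u d := lt_of_le_of_ne (not_lt.mp hlt) (Ne.symm hd)
  -- At this corner the positions before `d` count equally, while `d` itself counts only for `v`.
  refine absurd (h ((v d).val + 1) (d.val + 1)) (not_le.mpr (Finset.card_lt_card ?_))
  rw [Finset.ssubset_iff_of_subset]
  · exact ⟨d, by simp, by simp only [Finset.mem_filter, Fin.lt_def] at hgt ⊢; omega⟩
  · intro k hk
    simp only [Finset.mem_filter, Finset.mem_univ, true_and] at hk ⊢
    rcases lt_trichotomy k d with hkd | rfl | hkd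
    · rwa [← hpre k hkd]
    · simp
    · rw [Fin.lt_def] at hkd
      omega

/-- A permutation strictly below another one in the rank comparison can be raised by one
transposition. -/
theorem RankLE.exists_step {n : ℕ} {u v : Equiv.Perm (Fin n)} (h : RankLE u v) (hne : u ≠ v) :
    ∃ w, BruhatStep u w ∧ RankLE w v := by
  obtain ⟨d, hpre, hd⟩ := h.exists_first_diff hne
  have hex : ∃ j, d < j ∧ u d < u j ∧ u j ≤ v d := by
    refine ⟨u.symm (v d), ?_, by simpa using hd, by simp⟩
    rcases lt_trichotomy d (u.symm (v d)) with hlt | heq | hgt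
    · exact hlt
    · have := congrArg u heq
      rw [Equiv.apply_symm_apply] at this
      exact absurd this hd.ne
    · have := hpre _ hgt
      rw [Equiv.apply_symm_apply] at this
      exact absurd (v.injective this) hgt.ne'
  -- Leftmost choice: strictly between `d` and `j`, `u` takes no value in `(u d, v d]`.
  obtain ⟨j, ⟨hdj, huj, hujv⟩, hmin⟩ := WellFounded.has_min (wellFounded_lt (α := Fin n))
    {j | d < j ∧ u d < u j ∧ u j ≤ v d} hex
  refine ⟨u * Equiv.swap d j, ⟨_, ⟨d, j, hdj.ne, rfl⟩, rfl, invNumber_lt_mul_swap u hdj huj⟩, ?_⟩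
  intro a b
  have hs := rankCount_mul_swap u hdj huj a b
  split_ifs at hs with hab
  · obtain ⟨h1, h2, h3, h4⟩ := hab
    rw [Fin.le_def] at hujv
    have hac : a ≤ (v d).val + 1 := by omega
    have hu := rankCount_add_card u hac b
    have hv := rankCount_add_card v hac b
    have hr := h ((v d).val + 1) b
    -- Inside the box the swap costs one, so strictness is needed. By minimality of `j`, the
    -- positions counted for `u` all precede `d`, where `v` agrees; `v` also counts `d`.
    have hcard : (Finset.univ.filter fun k : Fin n =>
          k.val < b ∧ a ≤ (u k).val ∧ (u k).val < (v d).val + 1).card <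
        (Finset.univ.filter fun k : Fin n =>
          k.val < b ∧ a ≤ (v k).val ∧ (v k).val < (v d).val + 1).card := by
      refine Finset.card_lt_card ?_
      rw [Finset.ssubset_iff_of_subset]
      · refine ⟨d, ?_, ?_⟩ <;> simp only [Finset.mem_filter, Finset.mem_univ, true_and] <;> omega
      · intro k hk
        simp only [Finset.mem_filter, Finset.mem_univ, true_and] at hk ⊢
        rcases lt_trichotomy k d with hkd | rfl | hkd
        · rwa [← hpre k hkd]
        · omega
        · refine absurd ?_ (hmin k ⟨hkd, ?_, ?_⟩) <;> simp only [Fin.lt_def, Fin.le_def] <;> omega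
    omega
  · rw [add_zero] at hs
    rw [hs]
    exact h a b

theorem invNumber_le {n : ℕ} (σ : Equiv.Perm (Fin n)) : invNumber σ ≤ n * n := by
  simpa [invNumber] using Finset.card_filter_le (Finset.univ : Finset (Fin n × Fin n))
    (fun x => x.1 < x.2 ∧ σ x.2 < σ x.1)

theorem RankLE.bruhatLE {n : ℕ} {u v : Equiv.Perm (Fin n)} (h : RankLE u v) : BruhatLE u v := by
  induction hm : n * n - invNumber u using Nat.strong_induction_on generalizing u with
  | _ m ih =>
    by_cases hne : u = v
    · subst hne
      exact Relation.ReflTransGen.refl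
    · obtain ⟨w, hstep, hw⟩ := h.exists_step hne
      have hlt : invNumber u < invNumber w := hstep.choose_spec.2.2
      have hle := invNumber_le w
      exact Relation.ReflTransGen.head hstep (ih _ (by omega) hw rfl)

/-- The Bruhat order is the comparison of rank functions. -/
theorem bruhatLE_iff_rankLE {n : ℕ} {u v : Equiv.Perm (Fin n)} : BruhatLE u v ↔ RankLE u v :=
  ⟨BruhatLE.rankLE, RankLE.bruhatLE⟩

/-! ### Convolution entries as rank counts -/

theorem matConv_permMat_allOnes {n : ℕ} (σ : Equiv.Perm (Fin n)) (i j : Fin n) :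
    matConv (permMat σ) (allOnes n) i j = (rankCount σ (i.val + 1) (j.val + 1) : ℂ) := by
  simp only [matConv, allOnes, permMat, mul_one]
  rw [Finset.sum_comm]
  simp only [Finset.sum_ite_eq', Finset.mem_Iic]
  rw [Finset.sum_boole, rankCount]
  congr 2
  ext k
  simp only [Finset.mem_filter, Finset.mem_Iic, Finset.mem_univ, true_and, Fin.le_def]
  omega

/-- Matrix entries only give ranks at arguments from `1` to `n`; this truncates larger ones. -/
theorem rankCount_min {n : ℕ} (σ : Equiv.Perm (Fin n)) (a b : ℕ) :
    rankCount σ (min a n) (min b n) = rankCount σ a b := by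
  unfold rankCount
  congr 1
  ext k
  simp

theorem entryLE_matConv_iff_rankLE {n : ℕ} {u v : Equiv.Perm (Fin n)} :
    EntryLE (matConv (permMat v) (allOnes n)) (matConv (permMat u) (allOnes n)) ↔ RankLE u v := by
  have hcast : EntryLE (matConv (permMat v) (allOnes n)) (matConv (permMat u) (allOnes n)) ↔
      ∀ i j : Fin n, rankCount v (i.val + 1) (j.val + 1) ≤ rankCount u (i.val + 1) (j.val + 1) := by
    refine forall_congr' fun i => forall_congr' fun j => ?_
    rw [matConv_permMat_allOnes, matConv_permMat_allOnes]
    simp [Complex.le_def]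
  rw [hcast]
  refine ⟨fun h a b => ?_, fun h i j => h _ _⟩
  rw [← rankCount_min v, ← rankCount_min u]
  have ha : min a n ≤ n := min_le_right _ _
  have hb : min b n ≤ n := min_le_right _ _
  generalize min a n = a at ha ⊢
  generalize min b n = b at hb ⊢
  rcases a with _ | a
  · simp [rankCount]
  rcases b with _ | b
  · simp [rankCount]
  exact h ⟨a, ha⟩ ⟨b, hb⟩

theorem permMat_mul {n : ℕ} (σ τ : Equiv.Perm (Fin n)) :
    permMat σ * permMat τ = permMat (σ * τ) := by
  ext i j
  simp only [Matrix.mul_apply, permMat, mul_ite, mul_one, mul_zero, Finset.sum_ite_eq',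
    Finset.mem_univ, if_true]
  rfl

theorem permMat_transpose {n : ℕ} (σ : Equiv.Perm (Fin n)) :
    (permMat σ).transpose = permMat σ⁻¹ := by
  ext i j
  simp only [Matrix.transpose_apply, permMat, Equiv.Perm.eq_inv_iff_eq]
  exact if_congr eq_comm rfl rfl

theorem antiDiag_eq_permMat (n : ℕ) : antiDiag n = permMat Fin.revPerm := by
  ext i j
  have h : (i.val + j.val + 1 = n) ↔ i = Fin.revPerm j := by
    rw [Fin.ext_iff, Fin.revPerm_apply, Fin.val_rev]
    omega
  simp [antiDiag, permMat, h]

theorem permOf_antiDiag (n : ℕ) : permOf (isPermMat_antiDiag n) = Fin.revPerm :=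
  permMat_injective ((permMat_permOf _).trans (antiDiag_eq_permMat n))

theorem theoremT (n : ℕ) (hn : 1 ≤ n) (P Q : Matrix (Fin n) (Fin n) ℂ)
    (hP : IsPermMat P) (hQ : IsPermMat Q) :
    List.TFAE [
      BruhatLE (permOf hQ) (permOf hP),
      EntryLE (matConv P (allOnes n)) (matConv Q (allOnes n)),
      BruhatLE (permOf (isPermMat_antiDiag n) * permOf hP)
        (permOf (isPermMat_antiDiag n) * permOf hQ),
      EntryLE (matConv (antiDiag n * Q) (allOnes n)) (matConv (antiDiag n * P) (allOnes n)),
      BruhatLE (permOf hP * permOf (isPermMat_antiDiag n))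
        (permOf hQ * permOf (isPermMat_antiDiag n)),
      EntryLE (matConv (Q * antiDiag n) (allOnes n)) (matConv (P * antiDiag n) (allOnes n)),
      BruhatLE (permOf hQ)⁻¹ (permOf hP)⁻¹,
      EntryLE (matConv P.transpose (allOnes n)) (matConv Q.transpose (allOnes n))] := by
  have hP' := permMat_permOf hP
  have hQ' := permMat_permOf hQ
  rw [permOf_antiDiag, antiDiag_eq_permMat]
  generalize permOf hP = p at hP' ⊢
  generalize permOf hQ = q at hQ' ⊢
  subst hP' hQ'
  simp only [permMat_mul, permMat_transpose, bruhatLE_iff_rankLE, entryLE_matConv_iff_rankLE,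
    rankLE_revPerm_mul_iff, rankLE_mul_revPerm_iff, rankLE_inv_iff]
  simp +contextual [List.TFAE]
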